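/- Let $K$ be a real quadratic field with discriminant $D>0$ and let $F/K$ be a CM extension (a totally complex quadratic extension of $K$). Let $J\in M_3(F)$ be a Hermitian matrix, $h$ the corresponding Hermitian form $\langle z,w\rangle=w^HJz$ on $F^3$, and suppose that $h^{\sigma}$ has signature $(2,1)$ for a complex embedding $\sigma$ of $F$ (hence also for $\bar\sigma$) and that $h$ is (positive or negative) definite under the two other complex embeddings. Let $\Gamma=SU(h^{\sigma})\cap SL_3(\mathcal O_F)$, where $SL_3(\mathcal O_F)$ is embedded in $SL_3(\mathbb C)$ by $\sigma$; it acts on the complex hyperbolic plane $\mathbb B^2$, the set of lines in $\mathbb C^3$ on which $h^\sigma$ is negative. An element of $\Gamma$ is elliptic if it fixes a point of $\mathbb B^2$, and $u\in\mathbb B^2$ is an isolated elliptic point if it is an isolated point of the fixed locus in $\mathbb B^2$ of some elliptic $M\in\Gamma$ that fixes $u$. Consider the condition $(\ast)$ there is no $z\in\mathcal O_F$ which is not totally real and satisfies $|\varphi(z)|\le 3$ for all embeddings $\varphi:F\to\mathbb C$. There is an absolute constant $D_0'$ such that $(\ast)$ holds for all $F/K$ as above whose relative discriminant has norm greater than $D_0'$.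 Moreover, there is an absolute constant $D_0$ such that, for all $K,F,J,\sigma$ as above with $(\ast)$ and $D>D_0$ (in particular, whenever $D>D_0$ and the norm of the relative discriminant of $F/K$ is greater than $D_0'$), the stabilizer $G$ in $\Gamma$ of any isolated elliptic point $u$ is a finite group of order at most $48$, and at least one of the following holds: 1. $G$ is cyclic of order $n$ for some $n\in\{2,3,4,6\}$, and the eigenvalues of its elements on the line $u$ are exactly the $n$-th roots of unity; 2. $G$ is isomorphic to a finite subgroup of $SU(2)$ of order at most $24$; 3. $G$ has a subgroup of index $2$ that is isomorphic to a finite subgroup of $SU(2)$ of order at most $24$. -/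

import Mathlib

open Matrix NumberField
open scoped LinearAlgebra.Projectivization ComplexConjugate

noncomputable section

namespace BallQuotient

/-- The relative discriminant of an extension `F/K` of number fields: the ideal of `𝓞 K` that is
the relative norm of the different ideal. -/
def relDiscr (K F : Type) [Field K] [NumberField K] [Field F] [NumberField F] [Algebra K F] :
    Ideal (𝓞 K) :=
  Ideal.relNorm (𝓞 K) (differentIdeal (𝓞 K) (𝓞 F))

/-- There is no algebraic integer of `F` that is not totally real and has absolute value at most
`3` in every complex embedding. -/
def NoSmallNonrealInteger (F : Type) [Field F] [NumberField F] : Prop :=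
  ¬ ∃ z : 𝓞 F, (∃ φ : F →+* ℂ, (φ z).im ≠ 0) ∧ ∀ φ : F →+* ℂ, ‖φ z‖ ≤ 3

/-- `H` is the Gram matrix of a Hermitian form of signature `(2, 1)`. -/
def HasSignatureTwoOne (H : Matrix (Fin 3) (Fin 3) ℂ) : Prop :=
  ∃ T : GL (Fin 3) ℂ,
    H = (T : Matrix (Fin 3) (Fin 3) ℂ)ᴴ * diagonal ![1, 1, -1] * (T : Matrix (Fin 3) (Fin 3) ℂ)

/-- `H` is the Gram matrix of a (positive or negative) definite Hermitian form. -/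
def IsDefinite (H : Matrix (Fin 3) (Fin 3) ℂ) : Prop :=
  H.IsHermitian ∧
    ((∀ v : Fin 3 → ℂ, v ≠ 0 → 0 < (star v ⬝ᵥ (H *ᵥ v)).re) ∨
      (∀ v : Fin 3 → ℂ, v ≠ 0 → (star v ⬝ᵥ (H *ᵥ v)).re < 0))

/-- A Hermitian form over `F` (given by its Gram matrix `J`) which has signature `(2, 1)` under
`σ` (hence also under the conjugate of `σ`) and is definite under all other complex embeddings.
Under `σ` the matrix is Hermitian, which says that `J` is Hermitian over `F` if `F` is a CM field. -/
structure IsAdmissibleForm {F : Type} [Field F] (σ : F →+* ℂ) (J : Matrix (Fin 3) (Fin 3) F) :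
    Prop where
  signature : HasSignatureTwoOne (J.map σ)
  definite : ∀ φ : F →+* ℂ, φ ≠ σ → φ ≠ (starRingEnd ℂ).comp σ → IsDefinite (J.map φ)

/-- The complex hyperbolic plane `𝔹²` in the projective model: the lines in `ℂ³` on which the
form `⟨u, u⟩ = uᴴ H u` is negative. -/
def ball (H : Matrix (Fin 3) (Fin 3) ℂ) : Set (ℙ ℂ (Fin 3 → ℂ)) :=
  {p | (star p.rep ⬝ᵥ (H *ᵥ p.rep)).re < 0}

/-- The quotient topology on the complex projective plane. -/
instance : TopologicalSpace (ℙ ℂ (Fin 3 → ℂ)) :=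
  TopologicalSpace.coinduced
    (fun v : {v : Fin 3 → ℂ // v ≠ 0} => Projectivization.mk ℂ v.1 v.2) inferInstance

/-- The special unitary group `SU(H)` of a Hermitian form on `ℂ³`. -/
def SU (H : Matrix (Fin 3) (Fin 3) ℂ) : Subgroup (Matrix.SpecialLinearGroup (Fin 3) ℂ) where
  carrier := {A | (A : Matrix (Fin 3) (Fin 3) ℂ)ᴴ * H * (A : Matrix (Fin 3) (Fin 3) ℂ) = H}
  one_mem' := by simp
  mul_mem' := by
    intro A B hA hB
    have hA' : (A : Matrix (Fin 3) (Fin 3) ℂ)ᴴ * H * (A : Matrix (Fin 3) (Fin 3) ℂ) = H := hA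
    have hB' : (B : Matrix (Fin 3) (Fin 3) ℂ)ᴴ * H * (B : Matrix (Fin 3) (Fin 3) ℂ) = H := hB
    change ((A * B : Matrix.SpecialLinearGroup (Fin 3) ℂ) : Matrix (Fin 3) (Fin 3) ℂ)ᴴ * H *
      ((A * B : Matrix.SpecialLinearGroup (Fin 3) ℂ) : Matrix (Fin 3) (Fin 3) ℂ) = H
    have h : ((A * B : Matrix.SpecialLinearGroup (Fin 3) ℂ) : Matrix (Fin 3) (Fin 3) ℂ) =
      (A : Matrix (Fin 3) (Fin 3) ℂ) * (B : Matrix (Fin 3) (Fin 3) ℂ) := rfl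
    rw [h, conjTranspose_mul]
    calc _ = (B : Matrix (Fin 3) (Fin 3) ℂ)ᴴ *
          ((A : Matrix (Fin 3) (Fin 3) ℂ)ᴴ * H * (A : Matrix (Fin 3) (Fin 3) ℂ)) *
          (B : Matrix (Fin 3) (Fin 3) ℂ) := by simp only [Matrix.mul_assoc]
      _ = H := by rw [hA', hB']
  inv_mem' := by
    intro A hA
    have hA' : (A : Matrix (Fin 3) (Fin 3) ℂ)ᴴ * H * (A : Matrix (Fin 3) (Fin 3) ℂ) = H := hA
    have h1 : (A : Matrix (Fin 3) (Fin 3) ℂ) * ((A⁻¹ : Matrix.SpecialLinearGroup (Fin 3) ℂ) :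
        Matrix (Fin 3) (Fin 3) ℂ) = 1 := by
      have h := congrArg (fun X : Matrix.SpecialLinearGroup (Fin 3) ℂ => (X : Matrix (Fin 3) (Fin 3) ℂ))
        (mul_inv_cancel A)
      exact h
    change ((A⁻¹ : Matrix.SpecialLinearGroup (Fin 3) ℂ) : Matrix (Fin 3) (Fin 3) ℂ)ᴴ * H *
      ((A⁻¹ : Matrix.SpecialLinearGroup (Fin 3) ℂ) : Matrix (Fin 3) (Fin 3) ℂ) = H
    generalize ((A⁻¹ : Matrix.SpecialLinearGroup (Fin 3) ℂ) : Matrix (Fin 3) (Fin 3) ℂ) = B at h1 ⊢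
    have h2 : Bᴴ * (A : Matrix (Fin 3) (Fin 3) ℂ)ᴴ = 1 := by
      rw [← conjTranspose_mul, h1, conjTranspose_one]
    calc Bᴴ * H * B = Bᴴ * ((A : Matrix (Fin 3) (Fin 3) ℂ)ᴴ * H *
          (A : Matrix (Fin 3) (Fin 3) ℂ)) * B := by rw [hA']
      _ = (Bᴴ * (A : Matrix (Fin 3) (Fin 3) ℂ)ᴴ) * H *
          ((A : Matrix (Fin 3) (Fin 3) ℂ) * B) := by simp only [Matrix.mul_assoc]
      _ = H := by rw [h1, h2, Matrix.one_mul, Matrix.mul_one]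

section Lattice

variable {F : Type} [Field F] [NumberField F] (σ : F →+* ℂ) (J : Matrix (Fin 3) (Fin 3) F)

/-- The homomorphism `SL₃(𝓞 F) → SL₃(ℂ)` induced by the embedding `σ`. -/
def embed : Matrix.SpecialLinearGroup (Fin 3) (𝓞 F) →* Matrix.SpecialLinearGroup (Fin 3) ℂ :=
  Matrix.SpecialLinearGroup.map (σ.comp (algebraMap (𝓞 F) F))

/-- The arithmetic lattice `Γ = SU(h^σ) ∩ SL₃(𝓞 F)`. -/
def Gam : Subgroup (Matrix.SpecialLinearGroup (Fin 3) (𝓞 F)) :=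
  (SU (J.map σ)).comap (embed σ)

/-- The stabilizer in `Γ` of a point of the projective plane, `Γ` acting through `σ`. -/
def stab (p : ℙ ℂ (Fin 3 → ℂ)) : Subgroup (Gam σ J) :=
  (MulAction.stabilizer (Matrix.SpecialLinearGroup (Fin 3) ℂ) p).comap
    ((embed σ).comp (Gam σ J).subtype)

/-- The points of the ball fixed by an element of `Γ`. -/
def fixedLocus (M : Gam σ J) : Set (ℙ ℂ (Fin 3 → ℂ)) :=
  {p | p ∈ ball (J.map σ) ∧ M ∈ stab σ J p}

/-- An element of `Γ` is elliptic if it fixes at least one point of the ball. -/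
def IsElliptic (M : Gam σ J) : Prop :=
  (fixedLocus σ J M).Nonempty

/-- `p` is an isolated elliptic point: some elliptic element of its stabilizer has `p` as an
isolated point of its fixed locus in the ball. (The identity fixes the whole ball, which has no
isolated point, so it never serves as `M`.) -/
def IsIsolatedEllipticPoint (p : ℙ ℂ (Fin 3 → ℂ)) : Prop :=
  p ∈ ball (J.map σ) ∧ ∃ M ∈ stab σ J p, IsElliptic σ J M ∧
    ∃ U : Set (ℙ ℂ (Fin 3 → ℂ)), IsOpen U ∧ U ∩ fixedLocus σ J M = {p}

/-- The stabilizer of `p` is cyclic of order `n`, and the eigenvalues of its elements on the line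
`p` are exactly the `n`-th roots of unity. -/
def IsCyclicWithRootsOfUnity (p : ℙ ℂ (Fin 3 → ℂ)) (n : ℕ) : Prop :=
  IsCyclic (stab σ J p) ∧ Nat.card (stab σ J p) = n ∧
    ∀ ζ : ℂ, ζ ^ n = 1 ↔ ∃ M ∈ stab σ J p,
      (embed σ (M : Matrix.SpecialLinearGroup (Fin 3) (𝓞 F)) : Matrix (Fin 3) (Fin 3) ℂ) *ᵥ p.rep =
        ζ • p.rep

end Lattice

/-- `G` is isomorphic to a finite subgroup of `SU(2)` of order at most `24`. -/
def IsSmallSubgroupOfSU2 (G : Type*) [Group G] : Prop :=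
  ∃ S : Subgroup (specialUnitaryGroup (Fin 2) ℂ),
    Finite S ∧ Nat.card S ≤ 24 ∧ Nonempty (G ≃* S)

end BallQuotient

end

/-! The stabilizer G of a point u of the ball preserves a positive definite Hermitian form under
every complex embedding: under σ one reverses the sign of the form on the negative line u, under the
conjugate of σ one conjugates that form, and elsewhere the form is definite by assumption
(`exists_posDef_invariant`). Bounded entries in all embeddings make G finite, and the traces of its
elements are integers of F bounded by 3 in all embeddings. By (∗) such a trace is totally real,
hence lies in K, and D > 36 forces it into ℤ (`exists_int_eq_of_norm_le`).

G acts faithfully on the complement of u by matrices A in U(2), with eigenvalue conj(det A) on u, so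
tr A + conj(det A) is an integer. As tr A = det A · conj(tr A), either det A = 1 and tr A is an
integer, or A has eigenvalues 1 and δ = det A with δ + δ⁻¹ an integer (`det_eq_one_or_reflection`).
If det is trivial on G, or takes only the values ±1, then G or the index 2 kernel lies in SU(2) with
integral traces, and a linear programming bound on characters gives order at most 24. If some δ² ≠
1, a trace identity makes det injective, and G is cyclic of order 2, 3, 4 or 6
(`classification_of_integral_trace`).

The claim on relative discriminants is separate: for a nonreal integer z of F, the element z − z̄
lies in the different, so small conjugates of z bound the discriminant norm by 6⁴. -/

noncomputable section

namespace BallQuotient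

/-! ### Character sums and the order bound in SL₂. -/

/-- The symmetric square of the standard representation of `SL₂`. -/
def symSquare : Matrix.SpecialLinearGroup (Fin 2) ℂ →* Matrix (Fin 3) (Fin 3) ℂ where
  toFun g := !![g 0 0 ^ 2, g 0 0 * g 0 1, g 0 1 ^ 2;
    2 * g 0 0 * g 1 0, g 0 0 * g 1 1 + g 0 1 * g 1 0, 2 * g 0 1 * g 1 1;
    g 1 0 ^ 2, g 1 0 * g 1 1, g 1 1 ^ 2]
  map_one' := by
    ext i j; fin_cases i <;> fin_cases j <;> simp
  map_mul' g h := by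
    ext i j
    fin_cases i <;> fin_cases j <;>
      simp [Matrix.mul_apply, Fin.sum_univ_succ] <;> ring

theorem trace_symSquare (g : Matrix.SpecialLinearGroup (Fin 2) ℂ) :
    (symSquare g).trace = (g : Matrix (Fin 2) (Fin 2) ℂ).trace ^ 2 - 1 := by
  have h := g.det_coe
  rw [Matrix.det_fin_two] at h
  simp only [symSquare, MonoidHom.coe_mk, OneHom.coe_mk, Matrix.trace_fin_three,
    Matrix.trace_fin_two]
  simp
  linear_combination -h

theorem trace_inv_specialLinearGroup_two (g : Matrix.SpecialLinearGroup (Fin 2) ℂ) :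
    ((g⁻¹ : Matrix.SpecialLinearGroup (Fin 2) ℂ) : Matrix (Fin 2) (Fin 2) ℂ).trace =
      (g : Matrix (Fin 2) (Fin 2) ℂ).trace := by
  rw [Matrix.SpecialLinearGroup.SL2_inv_expl, Matrix.trace_fin_two, Matrix.trace_fin_two]
  simp [add_comm]

/-- The representation on column vectors defined by a matrix representation. -/
def matrixRep {G : Type*} [Group G] {n : ℕ} (ρ : G →* Matrix (Fin n) (Fin n) ℂ) :
    Representation ℂ G (Fin n → ℂ) :=
  (Matrix.toLinAlgEquiv' : Matrix (Fin n) (Fin n) ℂ ≃ₐ[ℂ] _).toMonoidHom.comp ρ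

theorem character_matrixRep {G : Type*} [Group G] {n : ℕ} (ρ : G →* Matrix (Fin n) (Fin n) ℂ)
    (g : G) : (matrixRep ρ).character g = (ρ g).trace :=
  Matrix.trace_toLin'_eq (ρ g)

theorem exists_sum_character_eq {G V : Type*} [Group G] [Fintype G] [AddCommGroup V] [Module ℂ V]
    [FiniteDimensional ℂ V] (ρ : Representation ℂ G V) :
    ∃ k : ℕ, ∑ g : G, ρ.character g = Nat.card G * k := by
  have h0 : (Nat.card G : ℂ) ≠ 0 := by exact_mod_cast Nat.card_pos.ne'
  let _ : Invertible (Nat.card G : ℂ) := invertibleOfNonzero h0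
  refine ⟨Module.finrank ℂ ρ.invariants, ?_⟩
  rw [← Representation.card_inv_mul_sum_char_eq_finrank ρ, mul_inv_cancel_left₀ h0]

/-- Here k is the dimension of the space of equivariant endomorphisms, which contains the identity.
Its positivity is what makes the order bound work. -/
theorem exists_sum_character_mul_inv_eq {G V : Type*} [Group G] [Fintype G] [AddCommGroup V]
    [Module ℂ V] [FiniteDimensional ℂ V] [Nontrivial V] (ρ : Representation ℂ G V) :
    ∃ k : ℕ, 0 < k ∧ ∑ g : G, ρ.character g * ρ.character g⁻¹ = Nat.card G * k := by
  have h0 : (Nat.card G : ℂ) ≠ 0 := by exact_mod_cast Nat.card_pos.ne'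
  let _ : Invertible (Nat.card G : ℂ) := invertibleOfNonzero h0
  refine ⟨Module.finrank ℂ (Representation.linHom ρ ρ).invariants, ?_, ?_⟩
  · rw [Module.finrank_pos_iff]
    refine ⟨⟨LinearMap.id, ?_⟩, 0, ?_⟩
    · intro g
      ext v
      simp [Representation.linHom_apply]
    · intro h
      obtain ⟨v, hv⟩ := exists_ne (0 : V)
      have := LinearMap.congr_fun (congrArg Subtype.val h) v
      exact hv (by simpa using this)
  · rw [← Representation.card_inv_mul_sum_char_eq_finrank, mul_inv_cancel_left₀ h0]
    refine Finset.sum_congr rfl fun g _ => ?_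
    rw [Representation.char_linHom, mul_comm]

/-- The linear programming bound for a finite group of quaternions whose traces are integers. -/
theorem card_le_of_trace_mem {G : Type*} [Group G] [Finite G]
    (ρ : G →* Matrix.SpecialLinearGroup (Fin 2) ℂ)
    (h : ∀ g : G, g ≠ 1 → (ρ g : Matrix (Fin 2) (Fin 2) ℂ).trace ∈ ({-2, -1, 0, 1} : Set ℂ)) :
    Nat.card G ≤ 24 := by
  classical
  have := Fintype.ofFinite G
  set V := matrixRep (Matrix.SpecialLinearGroup.coeMonoidHom.comp ρ) with hV
  set R := matrixRep (symSquare.comp ρ) with hR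
  have cV : ∀ g, V.character g = (ρ g : Matrix (Fin 2) (Fin 2) ℂ).trace := fun g =>
    character_matrixRep _ g
  have cR : ∀ g, R.character g = (ρ g : Matrix (Fin 2) (Fin 2) ℂ).trace ^ 2 - 1 := fun g => by
    rw [hR, character_matrixRep, MonoidHom.comp_apply, trace_symSquare]
  obtain ⟨a, ha⟩ := exists_sum_character_eq R
  obtain ⟨b, hb⟩ := exists_sum_character_eq (V.tprod R)
  obtain ⟨c, hc0, hc⟩ := exists_sum_character_mul_inv_eq R
  -- With t the trace, the summand is (t² − 1)² + (t² − 1) + 2t(t² − 1) = (t + 2)(t + 1)t(t − 1). It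
  -- vanishes at every permitted trace, and at the identity, where t = 2, it equals 24.
  have key : ∑ g : G, (R.character g * R.character g⁻¹ + R.character g +
      2 * (V.tprod R).character g) = 24 := by
    rw [Finset.sum_eq_single 1]
    · rw [Representation.char_tensor, Pi.mul_apply, cV, cR, cR]
      simp
      norm_num
    · intro g _ hg
      rw [Representation.char_tensor, Pi.mul_apply, cV, cR, cR, map_inv,
        trace_inv_specialLinearGroup_two]
      rcases h g hg with h | h | h | h <;> rw [h] <;> norm_num
    · simp
  rw [Finset.sum_add_distrib, Finset.sum_add_distrib, ← Finset.mul_sum, ha, hb, hc] at key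
  -- The three multiplicities are natural numbers and c ≥ 1, hence |G| ≤ 24.
  have key' : Nat.card G * (c + a + 2 * b) = 24 := by
    have : ((Nat.card G * (c + a + 2 * b) : ℕ) : ℂ) = (24 : ℕ) := by
      push_cast
      linear_combination key
    exact_mod_cast this
  nlinarith [Nat.zero_le (Nat.card G * a), Nat.zero_le (Nat.card G * b), Nat.zero_le (Nat.card G)]

/-! ### Traces and determinants in U(2). -/

section UnitaryTwo

variable {A : Matrix (Fin 2) (Fin 2) ℂ}

theorem det_mul_conj_det_of_mem_unitary (hA : A ∈ unitaryGroup (Fin 2) ℂ) :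
    A.det * conj A.det = 1 := by
  have h := congrArg Matrix.det (mem_unitaryGroup_iff.mp hA)
  rwa [det_mul, det_one, star_eq_conjTranspose, det_conjTranspose] at h

/-- For unitary A the adjugate is det A times the conjugate transpose, and a 2 × 2 matrix has the
same trace as its adjugate. -/
theorem trace_eq_det_mul_conj_trace (hA : A ∈ unitaryGroup (Fin 2) ℂ) :
    A.trace = A.det * conj A.trace := by
  have h : A.adjugate = A.det • Aᴴ := by
    calc A.adjugate = A.adjugate * (A * star A) := by rw [mem_unitaryGroup_iff.mp hA, mul_one]
      _ = A.det • Aᴴ := by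
        rw [← mul_assoc, adjugate_mul, smul_mul_assoc, one_mul, star_eq_conjTranspose]
  have h2 := congrArg Matrix.trace h
  rw [adjugate_fin_two, trace_smul, trace_conjTranspose, smul_eq_mul] at h2
  rw [← RCLike.star_def, ← h2, trace_fin_two, trace_fin_two]
  simp [add_comm]

-- The squared Hilbert–Schmidt norm of A − 1 is 4 − 2 Re tr A, which vanishes.
open scoped ComplexOrder in
theorem eq_one_of_trace_eq_two (hA : A ∈ unitaryGroup (Fin 2) ℂ) (ht : A.trace = 2) : A = 1 := by
  have h1 := mem_unitaryGroup_iff.mp hA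
  have h2 : ((A - 1) * (A - 1)ᴴ).trace = 0 := by
    rw [conjTranspose_sub, conjTranspose_one, sub_mul, mul_sub, mul_sub, ← star_eq_conjTranspose,
      h1, one_mul, mul_one, one_mul, trace_sub, trace_sub, trace_sub, star_eq_conjTranspose,
      trace_conjTranspose, ht]
    simp
  rw [trace_mul_conjTranspose_self_eq_zero_iff] at h2
  exact sub_eq_zero.mp h2

/-- A unitary `2 × 2` matrix which together with the inverse of its determinant has a real trace
either has determinant one or is a reflection. -/
theorem det_eq_one_or_reflection (hA : A ∈ unitaryGroup (Fin 2) ℂ) {k : ℝ}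
    (hk : A.trace + conj A.det = k) :
    (A.det = 1 ∧ A.trace = k - 1) ∨ (A.det ^ 2 + 1 = (k - 1) * A.det ∧ A.trace = 1 + A.det) := by
  have h1 := det_mul_conj_det_of_mem_unitary hA
  have h2 := trace_eq_det_mul_conj_trace hA
  have h3 : conj A.trace = k - A.det := by
    have := congrArg conj hk
    simp only [map_add, Complex.conj_conj, Complex.conj_ofReal] at this
    linear_combination this
  rw [h3] at h2
  generalize A.det = δ at *
  generalize conj δ = δ' at *
  generalize A.trace = τ at *
  have h4 : (δ - 1) * (δ ^ 2 + 1 - (k - 1) * δ) = 0 := by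
    linear_combination δ * h2 + h1 - δ * hk
  rcases mul_eq_zero.mp h4 with h | h
  · left
    have hd : δ = 1 := sub_eq_zero.mp h
    subst hd
    exact ⟨rfl, by linear_combination hk - h1⟩
  · right
    exact ⟨sub_eq_zero.mp h, by linear_combination h2 - h⟩

end UnitaryTwo

/-! ### Finite subgroups of U(2) with integral traces. -/

theorem intCast_cases_of_norm_le_two {t : ℂ} (ht : ‖t‖ ≤ 2) {k : ℤ} (hk : t = k) :
    k = -2 ∨ k = -1 ∨ k = 0 ∨ k = 1 ∨ k = 2 := by
  rw [hk, Complex.norm_intCast] at ht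
  have h : |k| ≤ 2 := by exact_mod_cast ht
  rw [abs_le] at h
  omega

theorem norm_trace_le_of_mem_unitary {n : ℕ} {A : Matrix (Fin n) (Fin n) ℂ}
    (hA : A ∈ unitaryGroup (Fin n) ℂ) : ‖A.trace‖ ≤ n := by
  calc ‖A.trace‖ ≤ ∑ i : Fin n, ‖A i i‖ := norm_sum_le _ _
    _ ≤ ∑ _i : Fin n, (1 : ℝ) := Finset.sum_le_sum fun i _ => entry_norm_bound_of_unitary hA i i
    _ = n := by simp

theorem smallSubgroup_of_integral_trace {G : Type*} [Group G] [Finite G]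
    (r : G →* unitaryGroup (Fin 2) ℂ) (hr : Function.Injective r)
    (hdet : ∀ g, (r g : Matrix (Fin 2) (Fin 2) ℂ).det = 1)
    (ht : ∀ g, ∃ k : ℤ, (r g : Matrix (Fin 2) (Fin 2) ℂ).trace = k) :
    Nat.card G ≤ 24 ∧ IsSmallSubgroupOfSU2 G := by
  have hcard : Nat.card G ≤ 24 := by
    let ρ : G →* Matrix.SpecialLinearGroup (Fin 2) ℂ :=
      { toFun := fun g => ⟨r g, hdet g⟩
        map_one' := by ext; simp
        map_mul' := fun g h => Subtype.ext (congrArg (fun x => x.1) (map_mul r g h)) }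
    refine card_le_of_trace_mem ρ fun g hg => ?_
    change (r g : Matrix (Fin 2) (Fin 2) ℂ).trace ∈ _
    obtain ⟨k, hk⟩ := ht g
    have hn := norm_trace_le_of_mem_unitary (r g).2
    rcases intCast_cases_of_norm_le_two (by exact_mod_cast hn) hk with h | h | h | h | h <;>
      rw [h] at hk <;> rw [hk]
    · simp
    · simp
    · simp
    · simp
    · exfalso
      refine hg (hr ?_)
      rw [map_one]
      exact Subtype.ext (eq_one_of_trace_eq_two (r g).2 (by rw [hk]; norm_num))
  let s : G →* specialUnitaryGroup (Fin 2) ℂ :=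
    { toFun := fun g => ⟨r g, mem_specialUnitaryGroup_iff.mpr ⟨(r g).2, hdet g⟩⟩
      map_one' := by ext; simp
      map_mul' := fun g h => by ext; simp }
  have hs : Function.Injective s := fun g h hgh => hr (Subtype.ext (congrArg (fun x => x.1) hgh))
  have e := MonoidHom.ofInjective hs
  refine ⟨hcard, s.range, Finite.of_equiv _ e.toEquiv, ?_, ⟨e⟩⟩
  rwa [← Nat.card_congr e.toEquiv]

/-- The |G| distinct values of χ are |G|-th roots of unity, of which there are at most |G|. -/
theorem pow_card_eq_one_iff_of_injective {G : Type*} [Group G] [Finite G] (χ : G →* ℂ)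
    (hχ : Function.Injective χ) (ζ : ℂ) : ζ ^ Nat.card G = 1 ↔ ∃ g, χ g = ζ := by
  classical
  have := Fintype.ofFinite G
  have hpos : 0 < Nat.card G := Nat.card_pos
  have hsub : Finset.univ.image χ ⊆ Polynomial.nthRootsFinset (Nat.card G) (1 : ℂ) := by
    intro z hz
    obtain ⟨g, -, rfl⟩ := Finset.mem_image.mp hz
    rw [Polynomial.mem_nthRootsFinset hpos, ← map_pow, pow_card_eq_one', map_one]
  have heq := Finset.eq_of_subset_of_card_le hsub (by
    rw [Finset.card_image_of_injective _ hχ, Finset.card_univ, ← Nat.card_eq_fintype_card]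
    exact (Multiset.toFinset_card_le _).trans (Polynomial.card_nthRoots _ _))
  rw [← Polynomial.mem_nthRootsFinset hpos, ← heq]
  simp

/-- G is cyclic, and the value z at a generator satisfies z + z⁻¹ = k. The values k = ±2, 0 give z⁴
= 1, and k = ±1 give z⁶ = 1. -/
theorem card_of_injective_of_quadratic {G : Type*} [Group G] [Finite G] (χ : G →* ℂ)
    (hχ : Function.Injective χ)
    (h : ∀ g, ∃ k : ℤ, (k = -2 ∨ k = -1 ∨ k = 0 ∨ k = 1 ∨ k = 2) ∧ χ g ^ 2 + 1 = k * χ g) :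
    Nat.card G ∣ 4 ∨ Nat.card G ∣ 6 := by
  have : IsCyclic G := isCyclic_of_injective_ringHom χ hχ
  obtain ⟨g, hg⟩ := IsCyclic.exists_generator (α := G)
  rw [← orderOf_eq_card_of_forall_mem_zpowers hg, ← orderOf_injective χ hχ, orderOf_dvd_iff_pow_eq_one,
    orderOf_dvd_iff_pow_eq_one]
  obtain ⟨k, hk, hkg⟩ := h g
  generalize χ g = z at *
  rcases hk with rfl | rfl | rfl | rfl | rfl <;> push_cast at hkg
  · left
    have : (z + 1) ^ 2 = 0 := by linear_combination hkg
    have : z = -1 := by linear_combination pow_eq_zero_iff (two_ne_zero) |>.mp this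
    rw [this]; norm_num
  · right; linear_combination (z - 1) * (z ^ 3 + 1) * hkg
  · left; linear_combination (z ^ 2 - 1) * hkg
  · right; linear_combination (z + 1) * (z ^ 3 - 1) * hkg
  · left
    have : (z - 1) ^ 2 = 0 := by linear_combination hkg
    have : z = 1 := by linear_combination pow_eq_zero_iff (two_ne_zero) |>.mp this
    rw [this]; norm_num

/-- Finite subgroups of `U(2)`, embedded in `SU(3)`, whose traces are rational integers. -/
theorem classification_of_integral_trace {G : Type*} [Group G] [Finite G]
    (r : G →* unitaryGroup (Fin 2) ℂ) (hr : Function.Injective r)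
    (ht : ∀ g, ∃ k : ℤ, (r g : Matrix (Fin 2) (Fin 2) ℂ).trace +
      conj (r g : Matrix (Fin 2) (Fin 2) ℂ).det = k) :
    Nat.card G ≤ 48 ∧
      ((∃ n : ℕ, (n = 2 ∨ n = 3 ∨ n = 4 ∨ n = 6) ∧ IsCyclic G ∧ Nat.card G = n ∧
        ∀ ζ : ℂ, ζ ^ n = 1 ↔ ∃ g, conj (r g : Matrix (Fin 2) (Fin 2) ℂ).det = ζ) ∨
      IsSmallSubgroupOfSU2 G ∨
      ∃ N : Subgroup G, N.index = 2 ∧ IsSmallSubgroupOfSU2 N) := by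
  let δ : G →* ℂ := Matrix.detMonoidHom.comp ((unitaryGroup (Fin 2) ℂ).subtype.comp r)
  have hδ : ∀ g, (r g : Matrix (Fin 2) (Fin 2) ℂ).det = δ g := fun g => rfl
  have hnorm : ∀ g, ‖δ g‖ = 1 := fun g => by
    have := det_mul_conj_det_of_mem_unitary (r g).2
    rw [hδ, Complex.mul_conj, Complex.normSq_eq_norm_sq] at this
    have h2 : ‖δ g‖ ^ 2 = 1 := by exact_mod_cast this
    exact (pow_eq_one_iff_of_nonneg (norm_nonneg _) two_ne_zero).mp h2
  have hcase : ∀ g, ∃ k : ℤ, (δ g = 1 ∧ (r g : Matrix (Fin 2) (Fin 2) ℂ).trace = k) ∨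
      (δ g ^ 2 + 1 = k * δ g ∧ (r g : Matrix (Fin 2) (Fin 2) ℂ).trace = 1 + δ g) := fun g => by
    obtain ⟨k, hk⟩ := ht g
    refine ⟨k - 1, ?_⟩
    have := det_eq_one_or_reflection (r g).2 (k := k) (by exact_mod_cast hk)
    push_cast at this ⊢
    exact this
  have htr1 : ∀ g, δ g ≠ 1 → (r g : Matrix (Fin 2) (Fin 2) ℂ).trace = 1 + δ g := fun g hg => by
    obtain ⟨k, h | h⟩ := hcase g
    · exact absurd h.1 hg
    · exact h.2
  have htr0 : ∀ g, δ g = 1 → ∃ k : ℤ, (r g : Matrix (Fin 2) (Fin 2) ℂ).trace = k := fun g hg => by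
    obtain ⟨k, h | h⟩ := hcase g
    · exact ⟨k, h.2⟩
    · exact ⟨2, by rw [h.2, hg]; norm_num⟩
  by_cases hsq : ∀ g, δ g ^ 2 = 1
  · by_cases hone : ∀ g, δ g = 1
    · obtain ⟨h1, h2⟩ := smallSubgroup_of_integral_trace r hr hone fun g => htr0 g (hone g)
      exact ⟨by omega, Or.inr (Or.inl h2)⟩
    · push Not at hone
      obtain ⟨a, ha⟩ := hone
      have hpm : ∀ g, δ g = 1 ∨ δ g = -1 := fun g => by
        simpa using sq_eq_sq_iff_eq_or_eq_neg.mp ((hsq g).trans (one_pow 2).symm)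
      have ha' : δ a = -1 := (hpm a).resolve_left ha
      have hidx : δ.ker.index = 2 := by
        rw [Subgroup.index_eq_two_iff]
        refine ⟨a, fun b => ?_⟩
        simp only [MonoidHom.mem_ker, map_mul, ha']
        rcases hpm b with h | h <;> rw [h] <;> norm_num [Xor]
      obtain ⟨h1, h2⟩ := smallSubgroup_of_integral_trace (r.comp δ.ker.subtype)
        (hr.comp Subtype.val_injective) (fun g => g.2) fun g => htr0 g g.2
      have := δ.ker.card_mul_index
      exact ⟨by rw [hidx] at this; omega, Or.inr (Or.inr ⟨δ.ker, hidx, h2⟩)⟩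
  · push Not at hsq
    obtain ⟨g, hg⟩ := hsq
    have hg1 : δ g ≠ 1 := fun h => hg (by rw [h, one_pow])
    -- Let h lie in the kernel. Since δ(g) and δ(g)² differ from 1, the elements g, gh and g²h are
    -- all reflections, with known traces. Cayley–Hamilton for A = r(g), multiplied by B = r(h),
    -- reads 1 + δ² = (1 + δ)² − δ tr B, so tr B = 2 and B = 1.
    have hinj : Function.Injective δ := by
      rw [injective_iff_map_eq_one]
      intro h hh
      have t1 := htr1 g hg1
      have t2 := htr1 (g * h) (by rwa [map_mul, hh, mul_one])
      have t3 := htr1 (g * g * h) (by rwa [map_mul, map_mul, hh, mul_one, ← sq])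
      have hd := hδ g
      rw [map_mul δ, hh, mul_one, map_mul, Submonoid.coe_mul] at t2
      rw [map_mul δ, map_mul δ, hh, mul_one] at t3
      rw [map_mul, map_mul, Submonoid.coe_mul, Submonoid.coe_mul] at t3
      have hB := (r h).2
      have hgoal : (r h : Matrix (Fin 2) (Fin 2) ℂ) = 1 → h = 1 := fun e =>
        hr (by rw [map_one]; exact Subtype.ext e)
      apply hgoal
      apply eq_one_of_trace_eq_two hB
      generalize (r g : Matrix (Fin 2) (Fin 2) ℂ) = A at *
      generalize (r h : Matrix (Fin 2) (Fin 2) ℂ) = B at *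
      have hne : δ g ≠ 0 := fun h0 => by simpa [h0] using hnorm g
      have key : (A * A * B).trace = A.trace * (A * B).trace - A.det * B.trace := by
        simp only [trace_fin_two, det_fin_two, Matrix.mul_apply, Fin.sum_univ_two]
        ring
      rw [t3, t1, t2, hd] at key
      have := mul_left_cancel₀ hne (show δ g * B.trace = δ g * 2 by linear_combination key)
      exact this
    -- The eigenvalue on the line u is the conjugate of the determinant on its complement.
    let χ : G →* ℂ := (starRingEnd ℂ).toMonoidHom.comp δ
    have hχ : Function.Injective χ := (starRingEnd ℂ).injective.comp hinj
    have hquad : ∀ g, ∃ k : ℤ, (k = -2 ∨ k = -1 ∨ k = 0 ∨ k = 1 ∨ k = 2) ∧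
        δ g ^ 2 + 1 = k * δ g := fun g => by
      obtain ⟨k, h | h⟩ := hcase g
      · exact ⟨2, by simp, by rw [h.1]; norm_num⟩
      · refine ⟨k, intCast_cases_of_norm_le_two (t := k) ?_ rfl, h.1⟩
        have h3 := congrArg norm h.1
        rw [norm_mul, hnorm, mul_one] at h3
        rw [← h3]
        calc ‖δ g ^ 2 + 1‖ ≤ ‖δ g ^ 2‖ + ‖(1 : ℂ)‖ := norm_add_le _ _
          _ = 2 := by rw [norm_pow, hnorm]; norm_num
    have hcyc : IsCyclic G := isCyclic_of_injective_ringHom δ hinj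
    have hn : Nat.card G = 2 ∨ Nat.card G = 3 ∨ Nat.card G = 4 ∨ Nat.card G = 6 := by
      have h1 : Nat.card G ≠ 1 := fun h => hg1 (by
        have := (Nat.card_eq_one_iff_unique.mp h).1
        rw [Subsingleton.elim g 1, map_one])
      rcases card_of_injective_of_quadratic δ hinj hquad with h | h
      · have := Nat.le_of_dvd (by norm_num) h
        interval_cases hc : Nat.card G <;> simp_all
      · have := Nat.le_of_dvd (by norm_num) h
        interval_cases hc : Nat.card G <;> simp_all
    refine ⟨by omega, Or.inl ⟨Nat.card G, hn, hcyc, rfl, fun ζ => ?_⟩⟩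
    exact pow_card_eq_one_iff_of_injective χ hχ ζ

/-! ### Small nonreal integers bound the relative discriminant. -/

section CM

variable (K : Type) {F : Type} [Field K] [NumberField K] [Field F] [NumberField F] [Algebra K F]
  [IsTotallyReal K] [IsTotallyComplex F]

omit [NumberField K] [NumberField F] [IsTotallyComplex F] in
theorem im_algebraMap_eq_zero (φ : F →+* ℂ) (x : K) : (φ (algebraMap K F x)).im = 0 := by
  have h := InfinitePlace.isReal_iff.mp
    (IsTotallyReal.isReal (InfinitePlace.mk (φ.comp (algebraMap K F))))
  have h2 : ComplexEmbedding.IsReal (φ.comp (algebraMap K F)) := by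
    rcases InfinitePlace.embedding_mk_eq (φ.comp (algebraMap K F)) with e | e
    · rwa [e] at h
    · rwa [e, ComplexEmbedding.isReal_conjugate_iff] at h
  exact Complex.conj_eq_iff_im.mp (RingHom.congr_fun (ComplexEmbedding.isReal_iff.mp h2) x)

theorem exists_algebraMap_eq_of_im_eq_zero (hd : Module.finrank K F = 2) {x : F}
    (hx : ∀ φ : F →+* ℂ, (φ x).im = 0) : ∃ y : K, algebraMap K F y = x := by
  have : Algebra.IsQuadraticExtension K F := ⟨hd⟩
  have : IsCMField F := IsCMField.ofCMExtension K F
  let φ : F →+* ℂ := Classical.choice inferInstance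
  have h : IsCMField.complexConj F x = x := φ.injective (by
    rw [IsCMField.complexEmbedding_complexConj, Complex.conj_eq_iff_im.mpr (hx φ)])
  rw [IsCMField.complexConj_eq_self_iff] at h
  exact ⟨(CMExtension.equivMaximalRealSubfield K F).symm ⟨x, h⟩,
    CMExtension.algebraMap_equivMaximalRealSubfield_symm_apply K F ⟨x, h⟩⟩

omit [NumberField K] [NumberField F] [IsTotallyComplex F] in
theorem adjoin_eq_top_of_im_ne_zero (hd : Module.finrank K F = 2) {x : F} {φ : F →+* ℂ}
    (hx : (φ x).im ≠ 0) : Algebra.adjoin K {x} = ⊤ := by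
  have := Subalgebra.isSimpleOrder_of_finrank_prime K F (hd ▸ Nat.prime_two)
  refine (eq_bot_or_eq_top (Algebra.adjoin K {x})).resolve_left fun h => ?_
  have hmem : x ∈ (⊥ : Subalgebra K F) := h ▸ Algebra.self_mem_adjoin_singleton K x
  obtain ⟨y, rfl⟩ := Algebra.mem_bot.mp hmem
  exact hx (im_algebraMap_eq_zero K φ y)

/-- The conjugate difference of an integral generator lies in the different. -/
theorem exists_mem_differentIdeal (hd : Module.finrank K F = 2) {z : 𝓞 F} {φ : F →+* ℂ}
    (hx : (φ z).im ≠ 0) :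
    ∃ d ∈ differentIdeal (𝓞 K) (𝓞 F), ∀ ψ : F →+* ℂ, ψ d = ψ z - conj (ψ z) := by
  have : Algebra.IsQuadraticExtension K F := ⟨hd⟩
  have : IsCMField F := IsCMField.ofCMExtension K F
  have htop := adjoin_eq_top_of_im_ne_zero K hd hx
  -- The element is f′(z) for the minimal polynomial f of z over 𝓞 K; f is quadratic with roots z
  -- and z̄, so f′(z) = z − z̄.
  refine ⟨_, aeval_derivative_mem_differentIdeal (𝓞 K) K F z htop, fun ψ => ?_⟩
  set f := minpoly (𝓞 K) z with hf
  have hint : IsIntegral (𝓞 K) z := IsIntegralClosure.isIntegral (𝓞 K) F z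
  have hmonic : f.Monic := minpoly.monic hint
  have hdeg : f.natDegree = 2 := by
    have h1 := minpoly.isIntegrallyClosed_eq_field_fractions K F hint
    have h2 : (minpoly K (algebraMap (𝓞 F) F z)).natDegree = 2 := by
      rw [← hd, ← Field.primitive_element_iff_minpoly_natDegree_eq,
        ← IntermediateField.toSubalgebra_inj,
        IntermediateField.adjoin_simple_toSubalgebra_of_isAlgebraic (Algebra.IsAlgebraic.isAlgebraic _),
        IntermediateField.top_toSubalgebra]
      exact htop
    rwa [h1, hmonic.natDegree_map] at h2
  have hsum := hmonic.as_sum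
  rw [hdeg, Finset.sum_range_succ, Finset.sum_range_one, pow_zero, mul_one, pow_one] at hsum
  set s := f.coeff 1
  set p := f.coeff 0
  have hroot : z ^ 2 + (algebraMap (𝓞 K) (𝓞 F) p + algebraMap (𝓞 K) (𝓞 F) s * z) = 0 := by
    have := minpoly.aeval (𝓞 K) z
    rw [← hf, hsum] at this
    simpa using this
  have hder : Polynomial.aeval z f.derivative = 2 * z + algebraMap (𝓞 K) (𝓞 F) s := by
    rw [hsum]
    simp [one_add_one_eq_two]
    exact Or.inl (map_ofNat _ 2)
  have hK : ∀ a : 𝓞 K, conj (ψ (algebraMap (𝓞 K) (𝓞 F) a)) = ψ (algebraMap (𝓞 K) (𝓞 F) a) :=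
    fun a => Complex.conj_eq_iff_im.mpr (im_algebraMap_eq_zero K ψ a)
  have e1 : ψ z ^ 2 + (ψ (algebraMap (𝓞 K) (𝓞 F) p) + ψ (algebraMap (𝓞 K) (𝓞 F) s) * ψ z) = 0 := by
    have := congrArg (fun w : 𝓞 F => ψ (w : F)) hroot
    simpa using this
  have e2 := congrArg conj e1
  simp only [map_add, map_mul, map_pow, hK, map_zero] at e2
  -- In a CM field complex conjugation commutes with all embeddings, so nonreal under φ means
  -- nonreal under ψ.
  have hne : ψ z - conj (ψ z) ≠ 0 := by
    intro h
    have h1 : ψ (IsCMField.complexConj F z) = ψ z := by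
      rw [IsCMField.complexEmbedding_complexConj]
      exact (sub_eq_zero.mp h).symm
    have h2 := congrArg φ (ψ.injective h1)
    rw [IsCMField.complexEmbedding_complexConj] at h2
    exact hx (Complex.conj_eq_iff_im.mp h2)
  have e3 := mul_left_cancel₀ hne (show (ψ z - conj (ψ z)) * (ψ (algebraMap (𝓞 K) (𝓞 F) s)) =
    (ψ z - conj (ψ z)) * (-ψ z - conj (ψ z)) by linear_combination e1 - e2)
  rw [hder]
  have : ψ ((2 * z + algebraMap (𝓞 K) (𝓞 F) s : 𝓞 F) : F) =
      2 * ψ z + ψ (algebraMap (𝓞 K) (𝓞 F) s) := by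
    simp [show algebraMap (𝓞 F) F 2 = 2 from map_ofNat _ 2]
    exact Or.inl (map_ofNat ψ 2)
  rw [this, e3]
  ring

/-- The discriminant norm is the absolute norm of the different, which divides the norm of z − z̄, a
product of conjugates each bounded by 2B. -/
theorem absNorm_relDiscr_le (hd : Module.finrank K F = 2) {z : 𝓞 F} {φ : F →+* ℂ}
    (hx : (φ z).im ≠ 0) {B : ℝ} (hB : ∀ ψ : F →+* ℂ, ‖ψ z‖ ≤ B) :
    (Ideal.absNorm (relDiscr K F) : ℝ) ≤ (2 * B) ^ Module.finrank ℚ F := by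
  obtain ⟨d, hmem, hval⟩ := exists_mem_differentIdeal K hd hx
  have hd0 : d ≠ 0 := by
    rintro rfl
    have h := hval φ
    rw [show ((0 : 𝓞 F) : F) = 0 from map_zero _, map_zero, eq_comm, sub_eq_zero] at h
    exact hx (Complex.conj_eq_iff_im.mp h.symm)
  have h1 : Ideal.absNorm (relDiscr K F) ∣ Ideal.absNorm (Ideal.span {d}) := by
    rw [relDiscr, Ideal.absNorm_relNorm]
    exact Ideal.absNorm_dvd_absNorm_of_le ((Ideal.span_singleton_le_iff_mem _).mpr hmem)
  rw [Ideal.absNorm_span_singleton] at h1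
  have h2 := Nat.le_of_dvd (Int.natAbs_pos.mpr (Algebra.norm_ne_zero_iff.mpr hd0)) h1
  have h3 : ((Algebra.norm ℤ d).natAbs : ℝ) = ‖((Algebra.norm ℤ d : ℚ) : ℂ)‖ := by
    rw [Rat.cast_intCast, Complex.norm_intCast, Nat.cast_natAbs, Int.cast_abs]
  have h4 : ((Algebra.norm ℤ d : ℚ) : ℂ) = ∏ σ : F →ₐ[ℚ] ℂ, σ d := by
    rw [Algebra.coe_norm_int, ← Algebra.norm_eq_prod_embeddings]
    rfl
  calc (Ideal.absNorm (relDiscr K F) : ℝ) ≤ ((Algebra.norm ℤ d).natAbs : ℝ) := by exact_mod_cast h2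
    _ = ∏ σ : F →ₐ[ℚ] ℂ, ‖σ d‖ := by rw [h3, h4, norm_prod]
    _ ≤ ∏ _σ : F →ₐ[ℚ] ℂ, (2 * B) := Finset.prod_le_prod (fun _ _ => norm_nonneg _) fun σ _ => by
        have e := hval (σ : F →+* ℂ)
        change σ d = σ z - conj (σ z) at e
        have hb := hB (σ : F →+* ℂ)
        change ‖σ z‖ ≤ B at hb
        rw [e]
        calc ‖σ z - conj (σ z)‖ ≤ ‖σ z‖ + ‖conj (σ z)‖ := norm_sub_le _ _
          _ ≤ 2 * B := by rw [Complex.norm_conj]; linarith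
    _ = (2 * B) ^ Module.finrank ℚ F := by
        rw [Finset.prod_const, Finset.card_univ, AlgHom.card]

end CM

/-! ### Integrality of small traces. -/

/-- An integer of a quadratic field all of whose conjugates are small compared to the discriminant
is a rational integer. -/
theorem exists_int_eq_of_conjugates_le {K : Type} [Field K] [NumberField K]
    (hK : Module.finrank ℚ K = 2) (hD : 36 < discr K) {y : 𝓞 K}
    (hy : ∀ ψ : K →+* ℂ, ‖ψ y‖ ≤ 3) :
    ∃ k : ℤ, (y : K) = k := by
  let b : Module.Basis (Fin 2) ℤ (𝓞 K) :=
    Module.finBasisOfFinrankEq ℤ (𝓞 K) ((RingOfIntegers.rank K).trans hK)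
  let P := b.toMatrix ![1, y]
  have hbP : (b : Fin 2 → 𝓞 K) ᵥ* P.map (algebraMap ℤ (𝓞 K)) = ![1, y] :=
    b.toMatrix_map_vecMul _
  have hdisc := Algebra.discr_of_matrix_vecMul (A := ℤ) b P
  rw [hbP, discr_eq_discr] at hdisc
  have htr : Algebra.trace ℤ (𝓞 K) (y * y) ≤ 18 := by
    have h1 : ((Algebra.trace ℤ (𝓞 K) (y * y) : ℚ) : ℂ) = ∑ σ : K →ₐ[ℚ] ℂ, σ (y * y) := by
      rw [Algebra.coe_trace_int, ← trace_eq_sum_embeddings]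
      simp
    have h2 : ‖((Algebra.trace ℤ (𝓞 K) (y * y) : ℚ) : ℂ)‖ ≤ 18 := by
      rw [h1]
      calc ‖∑ σ : K →ₐ[ℚ] ℂ, σ (y * y)‖ ≤ ∑ σ : K →ₐ[ℚ] ℂ, ‖σ (y * y)‖ := norm_sum_le _ _
        _ ≤ ∑ _σ : K →ₐ[ℚ] ℂ, (9 : ℝ) := Finset.sum_le_sum fun σ _ => by
            have hb := hy (σ : K →+* ℂ)
            change ‖σ y‖ ≤ 3 at hb
            rw [map_mul, norm_mul]
            nlinarith [norm_nonneg (σ y)]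
        _ = 18 := by
            rw [Finset.sum_const, Finset.card_univ, AlgHom.card, hK]
            norm_num
    rw [Rat.cast_intCast, Complex.norm_intCast] at h2
    have h3 := (le_abs_self _).trans h2
    exact_mod_cast h3
  have hdet : Algebra.discr ℤ ![1, y] =
      2 * Algebra.trace ℤ (𝓞 K) (y * y) - Algebra.trace ℤ (𝓞 K) y ^ 2 := by
    have h1 : Algebra.trace ℤ (𝓞 K) 1 = 2 := by
      have := Algebra.trace_algebraMap (R := ℤ) (S := 𝓞 K) 1
      rw [map_one, RingOfIntegers.rank, hK] at this
      simpa using this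
    rw [Algebra.discr_def, det_fin_two]
    simp [Algebra.traceMatrix_apply, Algebra.traceForm_apply, h1]
    ring
  -- The discriminant of (1, y) is det(P)² · D, but also 2 tr(y²) − (tr y)² ≤ 36 < D. So 1 and y are
  -- linearly dependent over ℤ, and y is rational.
  have hP : P.det = 0 := by
    by_contra h
    have h1 : 1 ≤ P.det ^ 2 := by
      have := sq_pos_of_ne_zero h
      omega
    nlinarith [sq_nonneg (Algebra.trace ℤ (𝓞 K) y)]
  obtain ⟨w, hw0, hw⟩ := exists_mulVec_eq_zero_iff.mpr hP
  have hrel : (w 0 : 𝓞 K) + w 1 * y = 0 := by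
    have h1 : (b : Fin 2 → 𝓞 K) ᵥ* P.map (algebraMap ℤ (𝓞 K)) ⬝ᵥ (fun i => (w i : 𝓞 K)) = 0 := by
      rw [← dotProduct_mulVec]
      have : P.map (algebraMap ℤ (𝓞 K)) *ᵥ (fun i => (w i : 𝓞 K)) = 0 := by
        ext i
        have := congrArg (Int.cast : ℤ → 𝓞 K) (congrFun hw i)
        simpa [mulVec, dotProduct] using congrArg (algebraMap (𝓞 K) K) this
      rw [this, dotProduct_zero]
    rw [hbP] at h1
    simpa [dotProduct, mul_comm] using h1
  have hw1 : w 1 ≠ 0 := by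
    intro h1
    rw [h1] at hrel
    have h0 : w 0 = 0 := by
      have : (w 0 : 𝓞 K) = 0 := by simpa using hrel
      exact_mod_cast this
    exact hw0 (by ext i; fin_cases i <;> simp [h0, h1])
  have hw1' : ((w 1 : ℤ) : K) ≠ 0 := by exact_mod_cast hw1
  have hrel' : ((w 0 : ℤ) : K) + w 1 * (y : K) = 0 := by
    have := congrArg (algebraMap (𝓞 K) K) hrel
    simpa using this
  have hq : (y : K) = algebraMap ℚ K (-(w 0 : ℚ) / w 1) := by
    rw [map_div₀, map_neg, map_intCast, map_intCast, eq_div_iff hw1']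
    linear_combination hrel'
  have hi : IsIntegral ℤ (-(w 0 : ℚ) / w 1) := by
    rw [← isIntegral_algebraMap_iff (algebraMap ℚ K).injective, ← hq]
    exact y.isIntegral_coe
  obtain ⟨k, hk⟩ := IsIntegrallyClosed.isIntegral_iff.mp hi
  refine ⟨k, ?_⟩
  rw [hq, ← hk]
  simp

/-- The integrality of small totally real integers of a CM field. -/
theorem exists_int_eq_of_norm_le (K : Type) {F : Type} [Field K] [NumberField K] [Field F]
    [NumberField F] [Algebra K F] [IsTotallyReal K] [IsTotallyComplex F]
    (hK : Module.finrank ℚ K = 2) (hd : Module.finrank K F = 2) (hD : 36 < discr K)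
    (hF : NoSmallNonrealInteger F) {z : 𝓞 F} (hz : ∀ φ : F →+* ℂ, ‖φ z‖ ≤ 3) :
    ∃ k : ℤ, (z : F) = k := by
  have him : ∀ φ : F →+* ℂ, (φ z).im = 0 := fun φ => by
    by_contra h
    exact hF ⟨z, ⟨φ, h⟩, hz⟩
  obtain ⟨y, hy⟩ := exists_algebraMap_eq_of_im_eq_zero K hd him
  have hint : IsIntegral ℤ y :=
    (isIntegral_algebraMap_iff (algebraMap K F).injective).mp (hy ▸ z.isIntegral_coe)
  let y' : 𝓞 K := ⟨y, hint⟩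
  obtain ⟨k, hk⟩ := exists_int_eq_of_conjugates_le hK hD (y := y') fun ψ => by
    change ‖ψ y‖ ≤ 3
    rw [← ComplexEmbedding.lift_algebraMap_apply F ψ, hy]
    exact hz _
  exact ⟨k, by rw [← hy, show y = k from hk, map_intCast]⟩

/-! ### Positive definite forms and unitary conjugation. -/

open scoped ComplexOrder in
theorem posDef_of_re_pos {n : ℕ} {H : Matrix (Fin n) (Fin n) ℂ} (hH : H.IsHermitian)
    (h : ∀ v : Fin n → ℂ, v ≠ 0 → 0 < (star v ⬝ᵥ (H *ᵥ v)).re) : H.PosDef :=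
  .of_dotProduct_mulVec_pos hH fun v hv =>
    Complex.pos_iff.mpr ⟨h v hv, (hH.im_star_dotProduct_mulVec_self v).symm⟩

open scoped ComplexOrder MatrixOrder in
theorem exists_conjTranspose_mul_self_of_posDef {n : ℕ} {H : Matrix (Fin n) (Fin n) ℂ}
    (hH : H.PosDef) : ∃ B : Matrix (Fin n) (Fin n) ℂ, IsUnit B ∧ H = Bᴴ * B := by
  obtain ⟨B, hB⟩ := CStarAlgebra.nonneg_iff_eq_star_mul_self.mp hH.posSemidef.nonneg
  refine ⟨B, ?_, hB⟩
  have hu := hH.isUnit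
  rw [hB] at hu
  rw [isUnit_iff_isUnit_det] at hu ⊢
  rw [det_mul] at hu
  exact isUnit_of_mul_isUnit_right hu

/-- A unitary matrix whose last column is proportional to a given vector. -/
theorem exists_unitary_mulVec_single (w : Fin 3 → ℂ) (hw : w ≠ 0) :
    ∃ W ∈ unitaryGroup (Fin 3) ℂ, ∃ c : ℂ, c ≠ 0 ∧ W *ᵥ Pi.single 2 1 = c • w := by
  have hw' : WithLp.toLp 2 w ≠ 0 := fun h => hw (by simpa using h)
  have hn : ‖WithLp.toLp 2 w‖ ≠ 0 := norm_ne_zero_iff.mpr hw'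
  set c : ℂ := ((‖WithLp.toLp 2 w‖ : ℝ) : ℂ)⁻¹ with hc
  have hc0 : c ≠ 0 := inv_ne_zero (by exact_mod_cast hn)
  have ho : Orthonormal ℂ (({2} : Set (Fin 3)).domRestrict
      fun _ : Fin 3 => c • WithLp.toLp 2 w) := by
    refine ⟨fun i => ?_, fun i j hij => absurd (Subsingleton.elim i j) hij⟩
    change ‖c • WithLp.toLp 2 w‖ = 1
    rw [norm_smul, hc, norm_inv, Complex.norm_real, norm_norm, inv_mul_cancel₀ hn]
  obtain ⟨b, hb⟩ := ho.exists_orthonormalBasis_extension_of_card_eq (by simp)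
  refine ⟨(EuclideanSpace.basisFun (Fin 3) ℂ).toBasis.toMatrix b,
    OrthonormalBasis.toMatrix_orthonormalBasis_mem_unitary _ _, c, hc0, ?_⟩
  ext i
  rw [mulVec_single_one]
  simp [Module.Basis.toMatrix_apply, hb 2 rfl]

open scoped ComplexOrder in
/-- The isometries of a positive definite form are simultaneously conjugate to unitary matrices, by
a change of basis whose last vector is proportional to a given one. -/
theorem exists_conj_mem_unitaryGroup {H : Matrix (Fin 3) (Fin 3) ℂ} (hH : H.PosDef)
    (v : Fin 3 → ℂ) (hv : v ≠ 0) :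
    ∃ B B' : Matrix (Fin 3) (Fin 3) ℂ, B * B' = 1 ∧ B' * B = 1 ∧
      (∃ c : ℂ, c ≠ 0 ∧ B' *ᵥ Pi.single 2 1 = c • v) ∧
      ∀ g : Matrix (Fin 3) (Fin 3) ℂ, gᴴ * H * g = H → B * g * B' ∈ unitaryGroup (Fin 3) ℂ := by
  obtain ⟨C, hC, rfl⟩ := exists_conjTranspose_mul_self_of_posDef hH
  obtain ⟨⟨C, C', hCC, hCC'⟩, rfl⟩ := hC
  change C * C' = 1 at hCC
  have hw : C *ᵥ v ≠ 0 := fun h => hv (by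
    have := congrArg (C' *ᵥ ·) h
    simpa [hCC'] using this)
  obtain ⟨W, hW, c, hc, hWc⟩ := exists_unitary_mulVec_single (C *ᵥ v) hw
  have hW1 : W * Wᴴ = 1 := mem_unitaryGroup_iff.mp hW
  have hW2 : Wᴴ * W = 1 := mem_unitaryGroup_iff'.mp hW
  have h1 : Wᴴ * C * (C' * W) = 1 := by
    rw [Matrix.mul_assoc, ← Matrix.mul_assoc C, hCC, Matrix.one_mul, hW2]
  have h2 : C' * W * (Wᴴ * C) = 1 := by
    rw [Matrix.mul_assoc, ← Matrix.mul_assoc W, hW1, Matrix.one_mul, hCC']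
  refine ⟨Wᴴ * C, C' * W, h1, h2, ⟨c, hc, ?_⟩, fun g hg => ?_⟩
  · rw [← mulVec_mulVec, hWc, mulVec_smul, mulVec_mulVec, hCC', one_mulVec]
  · change gᴴ * (Cᴴ * C) * g = Cᴴ * C at hg
    rw [mem_unitaryGroup_iff', star_eq_conjTranspose]
    simp only [conjTranspose_mul, conjTranspose_conjTranspose]
    calc Wᴴ * C'ᴴ * (gᴴ * (Cᴴ * W)) * (Wᴴ * C * g * (C' * W))
        = Wᴴ * C'ᴴ * (gᴴ * (Cᴴ * (W * Wᴴ) * C) * g) * (C' * W) := by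
          simp only [Matrix.mul_assoc]
      _ = Wᴴ * (C * C')ᴴ * (C * C') * W := by
          rw [hW1, Matrix.mul_one, hg, conjTranspose_mul]
          simp only [Matrix.mul_assoc]
      _ = 1 := by rw [hCC, conjTranspose_one, Matrix.mul_one, Matrix.mul_one, hW2]

open scoped ComplexOrder in
theorem norm_trace_le_of_isometry {H : Matrix (Fin 3) (Fin 3) ℂ} (hH : H.PosDef)
    {g : Matrix (Fin 3) (Fin 3) ℂ} (hg : gᴴ * H * g = H) : ‖g.trace‖ ≤ 3 := by
  -- Only the conjugation into the unitary group matters; the vector is an arbitrary nonzero one.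
  obtain ⟨B, B', -, h2, -, h⟩ := exists_conj_mem_unitaryGroup hH (Pi.single 0 1) (by simp)
  have := norm_trace_le_of_mem_unitary (h g hg)
  rw [trace_mul_comm, ← Matrix.mul_assoc, h2, Matrix.one_mul] at this
  exact_mod_cast this

open scoped ComplexOrder in
theorem exists_norm_entry_le_of_isometry {H : Matrix (Fin 3) (Fin 3) ℂ} (hH : H.PosDef) :
    ∃ C : ℝ, ∀ g : Matrix (Fin 3) (Fin 3) ℂ, gᴴ * H * g = H → ∀ i j, ‖g i j‖ ≤ C := by
  obtain ⟨B, B', -, h2, -, h⟩ := exists_conj_mem_unitaryGroup hH (Pi.single 0 1) (by simp)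
  refine ⟨∑ i, ∑ j, ∑ k, ∑ l, ‖B' i l‖ * ‖B k j‖, fun g hg i j => ?_⟩
  have hU := h g hg
  set U := B * g * B' with hUdef
  have hgU : g = B' * U * B := by
    rw [hUdef, ← Matrix.mul_assoc, ← Matrix.mul_assoc, h2, Matrix.one_mul, Matrix.mul_assoc, h2,
      Matrix.mul_one]
  have hnn : ∀ i j, 0 ≤ ∑ k, ∑ l, ‖B' i l‖ * ‖B k j‖ := fun i j =>
    Finset.sum_nonneg fun k _ => Finset.sum_nonneg fun l _ => by positivity
  calc ‖g i j‖ = ‖∑ k, ∑ l, B' i l * U l k * B k j‖ := by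
        simp only [hgU, Matrix.mul_apply, Finset.sum_mul]
    _ ≤ ∑ k, ∑ l, ‖B' i l‖ * ‖B k j‖ := by
        refine (norm_sum_le _ _).trans (Finset.sum_le_sum fun k _ => ?_)
        refine (norm_sum_le _ _).trans (Finset.sum_le_sum fun l _ => ?_)
        rw [norm_mul, norm_mul]
        have := entry_norm_bound_of_unitary hU l k
        nlinarith [mul_nonneg (norm_nonneg (B' i l)) (norm_nonneg (B k j))]
    _ ≤ ∑ j, ∑ k, ∑ l, ‖B' i l‖ * ‖B k j‖ :=
        Finset.single_le_sum (f := fun j => ∑ k, ∑ l, ‖B' i l‖ * ‖B k j‖)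
          (fun j _ => hnn i j) (Finset.mem_univ j)
    _ ≤ _ := Finset.single_le_sum (f := fun i => ∑ j, ∑ k, ∑ l, ‖B' i l‖ * ‖B k j‖)
          (fun i _ => Finset.sum_nonneg fun j _ => hnn i j) (Finset.mem_univ i)

/-! ### Forms of signature (2, 1) and their negative lines. -/

theorem HasSignatureTwoOne.isHermitian {H : Matrix (Fin 3) (Fin 3) ℂ} (h : HasSignatureTwoOne H) :
    H.IsHermitian := by
  obtain ⟨T, rfl⟩ := h
  refine isHermitian_conjTranspose_mul_mul _ (isHermitian_diagonal_of_self_adjoint _ ?_)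
  ext i
  fin_cases i <;> simp

/-- Orthogonality and Cauchy–Schwarz give |v₂|²|y₂|² ≤ (|v₀|² + |v₁|²)(|y₀|² + |y₁|²), and
negativity of v makes the first factor less than |v₂|². -/
theorem diagonal_orthogonal_pos {v y : Fin 3 → ℂ}
    (hv : (star v ⬝ᵥ (diagonal ![1, 1, -1] *ᵥ v)).re < 0)
    (hy : star v ⬝ᵥ (diagonal ![1, 1, -1] *ᵥ y) = 0) (hy0 : y ≠ 0) :
    0 < (star y ⬝ᵥ (diagonal ![1, 1, -1] *ᵥ y)).re := by
  have hform : ∀ x : Fin 3 → ℂ, (star x ⬝ᵥ (diagonal ![1, 1, -1] *ᵥ x)).re =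
      ‖x 0‖ ^ 2 + ‖x 1‖ ^ 2 - ‖x 2‖ ^ 2 := fun x => by
    simp only [dotProduct, Fin.sum_univ_three, mulVec_diagonal, ← Complex.normSq_eq_norm_sq,
      Complex.normSq_apply]
    simp
    ring
  rw [hform] at hv ⊢
  have h1 : conj (v 2) * y 2 = conj (v 0) * y 0 + conj (v 1) * y 1 := by
    simp [dotProduct, Fin.sum_univ_three, mulVec_diagonal] at hy
    linear_combination -hy
  have h2 : ‖v 2‖ * ‖y 2‖ ≤ ‖v 0‖ * ‖y 0‖ + ‖v 1‖ * ‖y 1‖ := by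
    calc ‖v 2‖ * ‖y 2‖ = ‖conj (v 2) * y 2‖ := by rw [norm_mul, Complex.norm_conj]
      _ ≤ ‖conj (v 0) * y 0‖ + ‖conj (v 1) * y 1‖ := by rw [h1]; exact norm_add_le _ _
      _ = _ := by simp only [norm_mul, Complex.norm_conj]
  have hv2 : 0 < ‖v 2‖ := by
    rcases (norm_nonneg (v 2)).eq_or_lt with h | h
    · rw [← h] at hv
      nlinarith [sq_nonneg ‖v 0‖, sq_nonneg ‖v 1‖]
    · exact h
  have hpos : 0 < ‖y 0‖ ^ 2 + ‖y 1‖ ^ 2 := by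
    by_contra hneg
    have h0 : ‖y 0‖ = 0 := by nlinarith [sq_nonneg ‖y 0‖, sq_nonneg ‖y 1‖]
    have h1' : ‖y 1‖ = 0 := by nlinarith [sq_nonneg ‖y 0‖, sq_nonneg ‖y 1‖]
    rw [h0, h1'] at h2
    have h3 : ‖y 2‖ = 0 := by
      nlinarith [norm_nonneg (y 2), mul_nonneg hv2.le (norm_nonneg (y 2))]
    apply hy0
    ext i
    fin_cases i
    · exact norm_eq_zero.mp h0
    · exact norm_eq_zero.mp h1'
    · exact norm_eq_zero.mp h3
  have h4 : (‖v 2‖ * ‖y 2‖) ^ 2 ≤ (‖v 0‖ * ‖y 0‖ + ‖v 1‖ * ‖y 1‖) ^ 2 :=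
    pow_le_pow_left₀ (by positivity) h2 2
  have h5 : (‖v 0‖ * ‖y 0‖ + ‖v 1‖ * ‖y 1‖) ^ 2 ≤
      (‖v 0‖ ^ 2 + ‖v 1‖ ^ 2) * (‖y 0‖ ^ 2 + ‖y 1‖ ^ 2) := by
    nlinarith [sq_nonneg (‖v 0‖ * ‖y 1‖ - ‖v 1‖ * ‖y 0‖)]
  have h6 : (‖v 0‖ ^ 2 + ‖v 1‖ ^ 2) * (‖y 0‖ ^ 2 + ‖y 1‖ ^ 2) <
      ‖v 2‖ ^ 2 * (‖y 0‖ ^ 2 + ‖y 1‖ ^ 2) := by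
    apply mul_lt_mul_of_pos_right _ hpos
    linarith
  have h7 : ‖v 2‖ ^ 2 * ‖y 2‖ ^ 2 < ‖v 2‖ ^ 2 * (‖y 0‖ ^ 2 + ‖y 1‖ ^ 2) := by
    rw [← mul_pow]
    linarith
  have h8 := lt_of_mul_lt_mul_left h7 (by positivity)
  linarith

theorem HasSignatureTwoOne.orthogonal_pos {H : Matrix (Fin 3) (Fin 3) ℂ}
    (h : HasSignatureTwoOne H) {v y : Fin 3 → ℂ} (hv : (star v ⬝ᵥ (H *ᵥ v)).re < 0)
    (hy : star v ⬝ᵥ (H *ᵥ y) = 0) (hy0 : y ≠ 0) : 0 < (star y ⬝ᵥ (H *ᵥ y)).re := by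
  obtain ⟨T, rfl⟩ := h
  have hform : ∀ a b : Fin 3 → ℂ,
      star a ⬝ᵥ (((T : Matrix (Fin 3) (Fin 3) ℂ)ᴴ * diagonal ![1, 1, -1] *
        (T : Matrix (Fin 3) (Fin 3) ℂ)) *ᵥ b) =
      star ((T : Matrix (Fin 3) (Fin 3) ℂ) *ᵥ a) ⬝ᵥ
        (diagonal ![1, 1, -1] *ᵥ ((T : Matrix (Fin 3) (Fin 3) ℂ) *ᵥ b)) := fun a b => by
    rw [← mulVec_mulVec, ← mulVec_mulVec, dotProduct_mulVec, star_mulVec]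
  rw [hform] at hv hy ⊢
  refine diagonal_orthogonal_pos hv hy fun h0 => hy0 ?_
  have := congrArg (((T⁻¹ : GL (Fin 3) ℂ) : Matrix (Fin 3) (Fin 3) ℂ) *ᵥ ·) h0
  simpa [mulVec_mulVec, ← Units.val_mul] using this

open scoped ComplexOrder in
/-- The stabilizer of a negative line in a unitary group of signature `(2, 1)` preserves a positive
definite form. -/
theorem HasSignatureTwoOne.exists_posDef {H : Matrix (Fin 3) (Fin 3) ℂ}
    (h : HasSignatureTwoOne H) {v : Fin 3 → ℂ} (hv : (star v ⬝ᵥ (H *ᵥ v)).re < 0) :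
    ∃ P : Matrix (Fin 3) (Fin 3) ℂ, P.PosDef ∧ ∀ g : Matrix (Fin 3) (Fin 3) ℂ,
      gᴴ * H * g = H → (∃ χ : ℂ, g *ᵥ v = χ • v) → gᴴ * P * g = P := by
  have hH := h.isHermitian
  set N : ℝ := (star v ⬝ᵥ (H *ᵥ v)).re with hN
  have hvv : star v ⬝ᵥ (H *ᵥ v) = N :=
    Complex.ext rfl (by rw [Complex.ofReal_im]; exact hH.im_star_dotProduct_mulVec_self v)
  have hNC : (N : ℂ) ≠ 0 := by exact_mod_cast hv.ne
  set u := H *ᵥ v with hu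
  have hustar : ∀ x, star u ⬝ᵥ x = star v ⬝ᵥ (H *ᵥ x) := fun x => by
    rw [hu, star_mulVec, hH.eq, dotProduct_mulVec]
  have hR : ∀ x, star x ⬝ᵥ u = conj (star u ⬝ᵥ x) := fun x => by
    rw [← RCLike.star_def, ← star_dotProduct_star, star_star]
  -- The coefficient −2/N changes the value on the line of v from N to −N and leaves the form on its
  -- orthogonal complement unchanged.
  let P := H + ((-2 / N : ℝ) : ℂ) • vecMulVec u (star u)
  have hPform : ∀ x, star x ⬝ᵥ (P *ᵥ x) = star x ⬝ᵥ (H *ᵥ x) +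
      ((-2 / N : ℝ) : ℂ) * (conj (star u ⬝ᵥ x) * (star u ⬝ᵥ x)) := fun x => by
    rw [add_mulVec, dotProduct_add, smul_mulVec, vecMulVec_mulVec, dotProduct_smul,
      op_smul_eq_smul, dotProduct_smul, hR]
    simp only [smul_eq_mul]
    ring
  refine ⟨P, posDef_of_re_pos ?_ ?_, ?_⟩
  · refine hH.add ?_
    rw [IsHermitian, conjTranspose_smul, conjTranspose_vecMulVec, star_star]
    simp
  · intro x hx
    set a : ℂ := (star u ⬝ᵥ x) / N with ha
    set y := x - a • v with hy
    have hxy : x = a • v + y := by rw [hy]; abel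
    have hux : star u ⬝ᵥ x = a * N := by rw [ha, div_mul_cancel₀ _ hNC]
    have huy : star v ⬝ᵥ (H *ᵥ y) = 0 := by
      rw [← hustar, hy, dotProduct_sub, dotProduct_smul, hux, hustar v, ← hu, hvv, smul_eq_mul,
        sub_self]
    have hyu : star y ⬝ᵥ u = 0 := by rw [hR, hustar, huy, map_zero]
    have hval : star x ⬝ᵥ (H *ᵥ x) = conj a * a * N + star y ⬝ᵥ (H *ᵥ y) := by
      rw [hxy, mulVec_add, mulVec_smul, star_add, star_smul, add_dotProduct, dotProduct_add,
        dotProduct_add, smul_dotProduct, smul_dotProduct, dotProduct_smul, dotProduct_smul, ← hu,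
        hvv, huy, hyu]
      simp
      ring
    have hre : (star x ⬝ᵥ (P *ᵥ x)).re = -(‖a‖ ^ 2 * N) + (star y ⬝ᵥ (H *ᵥ y)).re := by
      have : star x ⬝ᵥ (P *ᵥ x) = ((-(‖a‖ ^ 2 * N) : ℝ) : ℂ) + star y ⬝ᵥ (H *ᵥ y) := by
        have haa : conj a * a = ((‖a‖ ^ 2 : ℝ) : ℂ) := by
          rw [mul_comm, Complex.mul_conj, Complex.normSq_eq_norm_sq]
        rw [hPform, hval, hux, map_mul, Complex.conj_ofReal]
        push_cast at haa ⊢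
        field_simp
        linear_combination (-N : ℂ) * haa
      rw [this, Complex.add_re, Complex.ofReal_re]
    rw [hre]
    by_cases hy0 : y = 0
    · have ha0 : a ≠ 0 := by
        intro h0
        apply hx
        rw [hxy, h0, hy0]
        simp
      have := mul_pos (pow_pos (norm_pos_iff.mpr ha0) 2) (neg_pos.mpr hv)
      rw [hy0]
      simp
      linarith
    · have h1 := h.orthogonal_pos hv huy hy0
      have := mul_nonneg (sq_nonneg ‖a‖) (neg_pos.mpr hv).le
      linarith
  · rintro g hg ⟨χ, hχ⟩
    have h1 : u = χ • (gᴴ *ᵥ u) := by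
      calc u = (gᴴ * H * g) *ᵥ v := by rw [hg]
        _ = χ • (gᴴ *ᵥ u) := by
          rw [← mulVec_mulVec, hχ, mulVec_smul, ← mulVec_mulVec]
    have h2 : conj χ * χ = 1 := by
      have h3 : star v ⬝ᵥ ((gᴴ * H * g) *ᵥ v) = conj χ * χ * N := by
        rw [← mulVec_mulVec, ← mulVec_mulVec, dotProduct_mulVec, ← star_mulVec, hχ, mulVec_smul,
          star_smul, smul_dotProduct, dotProduct_smul, ← hu, hvv]
        simp
        ring
      rw [hg, hvv] at h3
      exact mul_right_cancel₀ hNC (by linear_combination -h3)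
    have h4 : gᴴ *ᵥ u = conj χ • u := by
      rw [h1, smul_smul, h2, one_smul, ← h1]
    have h5 : gᴴ * vecMulVec u (star u) * g = vecMulVec u (star u) := by
      rw [mul_vecMulVec, vecMulVec_mul, h4]
      have h6 : star u ᵥ* g = χ • star u := by
        have := congrArg star h4
        rw [star_mulVec, conjTranspose_conjTranspose, star_smul] at this
        simpa using this
      rw [h6, smul_vecMulVec, vecMulVec_smul, smul_smul, h2, one_smul]
    change gᴴ * (H + _) * g = _
    rw [Matrix.mul_add, Matrix.add_mul, hg, Matrix.mul_smul, Matrix.smul_mul, h5]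

/-- A special unitary representation with an invariant coordinate line, restricted to the
orthogonal complement. -/
theorem exists_unitary_two_of_block {G : Type*} [Group G] (U : G →* Matrix (Fin 3) (Fin 3) ℂ)
    (hU : ∀ g, U g ∈ unitaryGroup (Fin 3) ℂ) (hdet : ∀ g, (U g).det = 1)
    (h0 : ∀ g, U g 0 2 = 0) (h1 : ∀ g, U g 1 2 = 0) :
    ∃ r : G →* unitaryGroup (Fin 2) ℂ, ∀ g,
      (U g).trace = (r g : Matrix (Fin 2) (Fin 2) ℂ).trace +
        conj (r g : Matrix (Fin 2) (Fin 2) ℂ).det ∧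
      U g 2 2 = conj (r g : Matrix (Fin 2) (Fin 2) ℂ).det ∧ (r g = 1 → U g = 1) := by
  have hcol : ∀ g, conj (U g 2 2) * U g 2 0 = 0 ∧ conj (U g 2 2) * U g 2 1 = 0 ∧
      conj (U g 2 2) * U g 2 2 = 1 := fun g => by
    have h := mem_unitaryGroup_iff'.mp (hU g)
    have e0 := congrFun (congrFun h 2) 0
    have e1 := congrFun (congrFun h 2) 1
    have e2 := congrFun (congrFun h 2) 2
    simp [Matrix.mul_apply, Fin.sum_univ_three, star_apply, h0, h1] at e0 e1 e2
    exact ⟨by simpa using e0, by simpa using e1, e2⟩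
  -- The last column is a multiple of the last basis vector; orthogonality to the other columns then
  -- clears the last row.
  have hne : ∀ g, conj (U g 2 2) ≠ 0 := fun g h => by simpa [h] using (hcol g).2.2
  have hr0 : ∀ g, U g 2 0 = 0 := fun g => (mul_eq_zero.mp (hcol g).1).resolve_left (hne g)
  have hr1 : ∀ g, U g 2 1 = 0 := fun g => (mul_eq_zero.mp (hcol g).2.1).resolve_left (hne g)
  let A : G → Matrix (Fin 2) (Fin 2) ℂ := fun g => !![U g 0 0, U g 0 1; U g 1 0, U g 1 1]
  have hA : ∀ g, A g ∈ unitaryGroup (Fin 2) ℂ := fun g => by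
    have h := mem_unitaryGroup_iff.mp (hU g)
    rw [mem_unitaryGroup_iff]
    ext i j
    have e00 := congrFun (congrFun h 0) 0
    have e01 := congrFun (congrFun h 0) 1
    have e10 := congrFun (congrFun h 1) 0
    have e11 := congrFun (congrFun h 1) 1
    simp [Matrix.mul_apply, Fin.sum_univ_three, star_apply, h0, h1] at e00 e01 e10 e11
    fin_cases i <;> fin_cases j <;>
      simp [A, Matrix.mul_apply, Fin.sum_univ_two, star_apply, e00, e01, e10, e11]
  let r : G →* unitaryGroup (Fin 2) ℂ :=
    { toFun := fun g => ⟨A g, hA g⟩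
      map_one' := by
        ext i j
        fin_cases i <;> fin_cases j <;> simp [A]
      map_mul' := fun g h => by
        ext i j
        fin_cases i <;> fin_cases j <;>
          simp [A, Matrix.mul_apply, Fin.sum_univ_three, h0, h1] }
  have hdetA : ∀ g, U g 2 2 = conj (A g).det := fun g => by
    have h := det_mul_conj_det_of_mem_unitary (hA g)
    have h3 := hdet g
    rw [det_fin_three] at h3
    simp only [h0, h1, hr0, hr1] at h3
    have h4 : (A g).det * U g 2 2 = 1 := by
      simp only [A, det_fin_two_of]
      linear_combination h3
    have hA0 : (A g).det ≠ 0 := fun h => by simp [h] at h4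
    exact mul_left_cancel₀ hA0 (h4.trans h.symm)
  refine ⟨r, fun g => ⟨?_, hdetA g, fun hg => ?_⟩⟩
  · change _ = (A g).trace + conj (A g).det
    rw [← hdetA, trace_fin_three]
    simp [A, trace_fin_two]
  · have hA1 : A g = 1 := congrArg Subtype.val hg
    have h22 : U g 2 2 = 1 := by rw [hdetA, hA1, det_one, map_one]
    have e00 := congrFun (congrFun hA1 0) 0
    have e01 := congrFun (congrFun hA1 0) 1
    have e10 := congrFun (congrFun hA1 1) 0
    have e11 := congrFun (congrFun hA1 1) 1
    simp [A] at e00 e01 e10 e11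
    ext i j
    fin_cases i <;> fin_cases j <;> simp [*]

/-! ### The stabilizer of a point of the ball. -/

section Stabilizer

variable {F : Type} [Field F] {σ : F →+* ℂ} {J : Matrix (Fin 3) (Fin 3) F}

/-- The matrix of an element of `SL₃(𝓞 F)` under a complex embedding. -/
def embMatrix (φ : F →+* ℂ) : Matrix.SpecialLinearGroup (Fin 3) (𝓞 F) →*
    Matrix (Fin 3) (Fin 3) ℂ :=
  Matrix.SpecialLinearGroup.coeMonoidHom.comp (embed φ)

theorem embMatrix_apply (φ : F →+* ℂ) (g : Matrix.SpecialLinearGroup (Fin 3) (𝓞 F))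
    (i j : Fin 3) : embMatrix φ g i j = φ (g i j) := rfl

theorem det_embMatrix (φ : F →+* ℂ) (g : Matrix.SpecialLinearGroup (Fin 3) (𝓞 F)) :
    (embMatrix φ g).det = 1 := (embed φ g).2

theorem embMatrix_injective (φ : F →+* ℂ) : Function.Injective (embMatrix φ) := by
  intro g h hgh
  ext i j
  have := congrFun (congrFun hgh i) j
  rw [embMatrix_apply, embMatrix_apply] at this
  exact φ.injective this

theorem trace_embMatrix (φ : F →+* ℂ) (g : Matrix.SpecialLinearGroup (Fin 3) (𝓞 F)) :
    (embMatrix φ g).trace = φ ((g : Matrix (Fin 3) (Fin 3) (𝓞 F)).trace : 𝓞 F) := by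
  simp [Matrix.trace_fin_three, embMatrix_apply]

theorem embMatrix_conj (φ : F →+* ℂ) (g : Matrix.SpecialLinearGroup (Fin 3) (𝓞 F)) :
    embMatrix ((starRingEnd ℂ).comp φ) g = (embMatrix φ g)ᴴᵀ := rfl

theorem conjTranspose_embMatrix_mul (g : Gam σ J) :
    (embMatrix σ g.1)ᴴ * J.map σ * embMatrix σ g.1 = J.map σ := g.2

theorem exists_mulVec_rep_eq_smul {p : ℙ ℂ (Fin 3 → ℂ)} {g : Gam σ J} (hg : g ∈ stab σ J p) :
    ∃ χ : ℂ, embMatrix σ g.1 *ᵥ p.rep = χ • p.rep := by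
  have h : (embed σ g.1) • p = p := hg
  rw [← p.mk_rep, Projectivization.matrixSpecialLinearGroup_smul_def, Projectivization.smul_mk,
    Projectivization.mk_eq_mk_iff'] at h
  obtain ⟨a, ha⟩ := h
  exact ⟨a, ha.symm⟩

variable [NumberField F]

/-- The isometry equation over a CM field holds under all embeddings. -/
theorem conjTranspose_embMatrix_mul_of_isCMField [IsCMField F] (φ : F →+* ℂ) (g : Gam σ J) :
    (embMatrix φ g.1)ᴴ * J.map φ * embMatrix φ g.1 = J.map φ := by
  let A : Matrix (Fin 3) (Fin 3) F := (g.1 : Matrix (Fin 3) (Fin 3) (𝓞 F)).map (algebraMap (𝓞 F) F)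
  let c : F →+* F := (IsCMField.complexConj F : F →+* F)
  have hc : ∀ ψ : F →+* ℂ, (embMatrix ψ g.1)ᴴ = ((A.map c)ᵀ).map ψ := fun ψ => by
    ext i j
    exact (IsCMField.complexEmbedding_complexConj F ψ _).symm
  have hm : ∀ ψ : F →+* ℂ, (embMatrix ψ g.1)ᴴ * J.map ψ * embMatrix ψ g.1 =
      ((A.map c)ᵀ * J * A).map ψ := fun ψ => by
    rw [hc, Matrix.map_mul, Matrix.map_mul]
    rfl
  have h := conjTranspose_embMatrix_mul g
  rw [hm] at h ⊢
  -- Both sides come from matrices over F, so the identity known under σ holds over F and passes to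
  -- φ.
  rw [Matrix.map_injective σ.injective h]

open scoped ComplexOrder in
/-- Under every embedding the stabilizer of a point of the ball preserves a positive definite
form. -/
theorem exists_posDef_invariant [IsCMField F] (hJ : IsAdmissibleForm σ J) {p : ℙ ℂ (Fin 3 → ℂ)}
    (hp : p ∈ ball (J.map σ)) (φ : F →+* ℂ) :
    ∃ P : Matrix (Fin 3) (Fin 3) ℂ, P.PosDef ∧
      ∀ g ∈ stab σ J p, (embMatrix φ g.1)ᴴ * P * embMatrix φ g.1 = P := by
  obtain ⟨P, hP, hinv⟩ := hJ.signature.exists_posDef hp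
  have hσ : ∀ g ∈ stab σ J p, (embMatrix σ g.1)ᴴ * P * embMatrix σ g.1 = P := fun g hg =>
    hinv _ (conjTranspose_embMatrix_mul g) (exists_mulVec_rep_eq_smul hg)
  by_cases h1 : φ = σ
  · subst h1
    exact ⟨P, hP, hσ⟩
  by_cases h2 : φ = (starRingEnd ℂ).comp σ
  · subst h2
    refine ⟨Pᵀ, hP.transpose, fun g hg => ?_⟩
    have := congrArg transpose (hσ g hg)
    rw [transpose_mul, transpose_mul, ← Matrix.mul_assoc] at this
    have hT : ((embMatrix σ g.1)ᴴᵀ)ᴴ = (embMatrix σ g.1)ᵀ := by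
      ext i j
      simp
    rwa [embMatrix_conj, hT]
  · obtain ⟨hH, hpos | hneg⟩ := hJ.definite φ h1 h2
    · exact ⟨_, posDef_of_re_pos hH hpos, fun g _ => conjTranspose_embMatrix_mul_of_isCMField φ g⟩
    · refine ⟨-J.map φ, posDef_of_re_pos hH.neg fun v hv => ?_, fun g _ => ?_⟩
      · rw [neg_mulVec, dotProduct_neg, Complex.neg_re]
        exact neg_pos.mpr (hneg v hv)
      · rw [Matrix.mul_neg, Matrix.neg_mul, conjTranspose_embMatrix_mul_of_isCMField]

/-- The matrix entries are integers of F bounded uniformly in all embeddings, and there are finitely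
many of these. -/
theorem finite_stab [IsCMField F] (hJ : IsAdmissibleForm σ J) {p : ℙ ℂ (Fin 3 → ℂ)}
    (hp : p ∈ ball (J.map σ)) : Finite (stab σ J p) := by
  have hC : ∀ φ : F →+* ℂ, ∃ C : ℝ, ∀ g ∈ stab σ J p, ∀ i j, ‖embMatrix φ g.1 i j‖ ≤ C :=
    fun φ => by
      obtain ⟨P, hP, hinv⟩ := exists_posDef_invariant hJ hp φ
      obtain ⟨C, hC⟩ := exists_norm_entry_le_of_isometry hP
      exact ⟨C, fun g hg => hC _ (hinv g hg)⟩
  choose C hC using hC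
  obtain ⟨B, hB⟩ := Finite.bddAbove_range C
  have hfin := Embeddings.finite_of_norm_le F ℂ B
  have hfin2 := Set.Finite.pi' fun _ : Fin 3 => Set.Finite.pi' fun _ : Fin 3 => hfin
  refine (Set.Finite.of_injOn (s := (stab σ J p : Set (Gam σ J)))
    (f := fun g i j => ((g.1 i j : 𝓞 F) : F)) ?_ ?_ hfin2).to_subtype
  · intro g hg i j
    exact ⟨(g.1 i j).isIntegral_coe, fun φ => (hC φ g hg i j).trans (hB ⟨φ, rfl⟩)⟩
  · intro g _ h _ hgh
    refine Subtype.ext ?_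
    ext i j
    exact congrFun (congrFun hgh i) j

/-- The action of the stabilizer of a point of the ball on the orthogonal complement of the
corresponding line. -/
theorem exists_unitary_two [IsCMField F] (hJ : IsAdmissibleForm σ J) {p : ℙ ℂ (Fin 3 → ℂ)}
    (hp : p ∈ ball (J.map σ)) :
    ∃ r : stab σ J p →* unitaryGroup (Fin 2) ℂ, Function.Injective r ∧ ∀ g,
      (embMatrix σ g.1.1).trace = (r g : Matrix (Fin 2) (Fin 2) ℂ).trace +
        conj (r g : Matrix (Fin 2) (Fin 2) ℂ).det ∧
      embMatrix σ g.1.1 *ᵥ p.rep = conj (r g : Matrix (Fin 2) (Fin 2) ℂ).det • p.rep := by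
  obtain ⟨P, hP, hinv⟩ := exists_posDef_invariant hJ hp σ
  obtain ⟨B, B', h1, h2, ⟨c, hc, hB⟩, hU⟩ := exists_conj_mem_unitaryGroup hP p.rep p.rep_nonzero
  let U : stab σ J p →* Matrix (Fin 3) (Fin 3) ℂ :=
    { toFun := fun g => B * embMatrix σ g.1.1 * B'
      map_one' := by
        change B * embMatrix σ 1 * B' = 1
        rw [map_one, Matrix.mul_one, h1]
      map_mul' := fun g h => by
        change B * embMatrix σ (g.1.1 * h.1.1) * B' = _
        rw [map_mul]
        simp only [Matrix.mul_assoc]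
        rw [← Matrix.mul_assoc B' B, h2, Matrix.one_mul] }
  have hUdef : ∀ g, U g = B * embMatrix σ g.1.1 * B' := fun g => rfl
  have hback : ∀ g, embMatrix σ g.1.1 = B' * U g * B := fun g => by
    rw [hUdef, Matrix.mul_assoc, Matrix.mul_assoc, h2, Matrix.mul_one, ← Matrix.mul_assoc, h2,
      Matrix.one_mul]
  have hBv : B *ᵥ p.rep = c⁻¹ • Pi.single 2 1 := by
    have := congrArg (B *ᵥ ·) hB
    simp only [mulVec_mulVec, h1, one_mulVec, mulVec_smul] at this
    rw [this, smul_smul, inv_mul_cancel₀ hc, one_smul]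
  have hcol : ∀ g, ∃ χ : ℂ, U g *ᵥ Pi.single 2 1 = χ • Pi.single 2 1 ∧
      embMatrix σ g.1.1 *ᵥ p.rep = χ • p.rep := fun g => by
    obtain ⟨χ, hχ⟩ := exists_mulVec_rep_eq_smul g.2
    refine ⟨χ, ?_, hχ⟩
    rw [hUdef, ← mulVec_mulVec, hB, ← mulVec_mulVec, mulVec_smul, hχ, mulVec_smul, mulVec_smul,
      hBv, smul_comm c χ, smul_smul c, mul_inv_cancel₀ hc, one_smul]
  have hentry : ∀ g i (χ : ℂ), U g *ᵥ Pi.single 2 1 = χ • Pi.single 2 1 →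
      U g i 2 = χ * (Pi.single 2 1 : Fin 3 → ℂ) i := fun g i χ h => by
    have := congrFun h i
    rwa [mulVec_single_one] at this
  obtain ⟨r, hr⟩ := exists_unitary_two_of_block U (fun g => hU _ (hinv g.1 g.2))
    (fun g => by
      rw [hUdef, det_mul, det_mul, det_embMatrix, mul_one, ← det_mul, h1, det_one])
    (fun g => by
      obtain ⟨χ, h, -⟩ := hcol g
      simpa using hentry g 0 χ h)
    (fun g => by
      obtain ⟨χ, h, -⟩ := hcol g
      simpa using hentry g 1 χ h)
  refine ⟨r, (injective_iff_map_eq_one r).mpr fun g hg => ?_, fun g => ⟨?_, ?_⟩⟩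
  · have h3 := hback g
    rw [(hr g).2.2 hg, Matrix.mul_one, h2, ← map_one (embMatrix σ)] at h3
    exact Subtype.ext (Subtype.ext (embMatrix_injective σ h3))
  · rw [← (hr g).1, hUdef, trace_mul_comm, ← Matrix.mul_assoc, h2, Matrix.one_mul]
  · obtain ⟨χ, h, h'⟩ := hcol g
    rw [h', ← (hr g).2.1, hentry g 2 χ h]
    simp

theorem stab_classification (K : Type) [Field K] [NumberField K] [Algebra K F] [IsTotallyReal K]
    [IsTotallyComplex F] (hK : Module.finrank ℚ K = 2) (hd : Module.finrank K F = 2)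
    (hF : NoSmallNonrealInteger F) (hD : 36 < discr K) (hJ : IsAdmissibleForm σ J)
    {p : ℙ ℂ (Fin 3 → ℂ)} (hp : p ∈ ball (J.map σ)) :
    Finite (stab σ J p) ∧ Nat.card (stab σ J p) ≤ 48 ∧
      ((∃ n : ℕ, (n = 2 ∨ n = 3 ∨ n = 4 ∨ n = 6) ∧ IsCyclicWithRootsOfUnity σ J p n) ∨
        IsSmallSubgroupOfSU2 (stab σ J p) ∨
        ∃ N : Subgroup (stab σ J p), N.index = 2 ∧ IsSmallSubgroupOfSU2 N) := by
  have : Algebra.IsQuadraticExtension K F := ⟨hd⟩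
  have : IsCMField F := IsCMField.ofCMExtension K F
  have hfin := finite_stab hJ hp
  obtain ⟨r, hr, hrg⟩ := exists_unitary_two hJ hp
  obtain ⟨h48, hcases⟩ := classification_of_integral_trace r hr fun g => by
    obtain ⟨k, hk⟩ := exists_int_eq_of_norm_le K hK hd hD hF
      (z := (g.1.1 : Matrix (Fin 3) (Fin 3) (𝓞 F)).trace) fun φ => by
        obtain ⟨P, hP, hinv⟩ := exists_posDef_invariant hJ hp φ
        rw [← trace_embMatrix]
        exact norm_trace_le_of_isometry hP (hinv g.1 g.2)
    exact ⟨k, by rw [← (hrg g).1, trace_embMatrix, hk, map_intCast]⟩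
  refine ⟨hfin, h48, hcases.imp_left ?_⟩
  rintro ⟨n, hn, hcyc, hcard, hroots⟩
  refine ⟨n, hn, hcyc, hcard, fun ζ => (hroots ζ).trans ⟨?_, ?_⟩⟩
  · rintro ⟨g, rfl⟩
    exact ⟨g.1, g.2, (hrg g).2⟩
  · rintro ⟨M, hM, hMζ⟩
    refine ⟨⟨M, hM⟩, smul_left_injective ℂ p.rep_nonzero ?_⟩
    exact (hrg ⟨M, hM⟩).2.symm.trans hMζ

end Stabilizer

end BallQuotient
end

theorem mainTheorem7 :
    (∃ D₀' : ℕ, ∀ (K F : Type) [Field K] [NumberField K] [Field F] [NumberField F] [Algebra K F],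
      IsTotallyReal K → Module.finrank ℚ K = 2 →
      IsTotallyComplex F → Module.finrank K F = 2 →
      D₀' < Ideal.absNorm (BallQuotient.relDiscr K F) →
      BallQuotient.NoSmallNonrealInteger F) ∧
    (∃ D₀ : ℕ, ∀ (K F : Type) [Field K] [NumberField K] [Field F] [NumberField F] [Algebra K F],
      IsTotallyReal K → Module.finrank ℚ K = 2 →
      IsTotallyComplex F → Module.finrank K F = 2 →
      BallQuotient.NoSmallNonrealInteger F →
      (D₀ : ℤ) < discr K →
      ∀ (σ : F →+* ℂ) (J : Matrix (Fin 3) (Fin 3) F), BallQuotient.IsAdmissibleForm σ J →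
      ∀ p : ℙ ℂ (Fin 3 → ℂ), BallQuotient.IsIsolatedEllipticPoint σ J p →
        Finite (BallQuotient.stab σ J p) ∧
        Nat.card (BallQuotient.stab σ J p) ≤ 48 ∧
        ((∃ n : ℕ, (n = 2 ∨ n = 3 ∨ n = 4 ∨ n = 6) ∧
            BallQuotient.IsCyclicWithRootsOfUnity σ J p n) ∨
          BallQuotient.IsSmallSubgroupOfSU2 (BallQuotient.stab σ J p) ∨
          ∃ N : Subgroup (BallQuotient.stab σ J p), N.index = 2 ∧
            BallQuotient.IsSmallSubgroupOfSU2 N)) := by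
  -- Here 6 = 2 · 3 bounds |z − z̄| and 4 = [F : ℚ], while 36 = 2 · 18 bounds 2 tr(y²) when both
  -- conjugates of y are at most 3 in absolute value.
  refine ⟨⟨6 ^ 4, ?_⟩, ⟨36, ?_⟩⟩
  · intro K F _ _ _ _ _ _ hK _ hd hlt
    rintro ⟨z, ⟨φ, hφ⟩, hz⟩
    have h := BallQuotient.absNorm_relDiscr_le K hd hφ hz
    rw [← Module.finrank_mul_finrank ℚ K F, hK, hd] at h
    norm_num at h
    have h' : Ideal.absNorm (BallQuotient.relDiscr K F) ≤ 1296 := by exact_mod_cast h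
    omega
  · intro K F _ _ _ _ _ _ hK _ hd hF hD σ J hJ p hp
    exact BallQuotient.stab_classification K hK hd hF hD hJ hp.1
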